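/- **Setting.** Let $X$ be a nonempty set, let $\xi_1,\xi_2,\dots$ be an i.i.d. sample with law $P$ on a measurable space $\Xi$, defined on a probability space $(\Omega,\mathcal F,\mathbb P)$, and let $h:X\times\Xi\to\mathbb R$ be such that each $h(x,\cdot)$ is measurable and $P$-integrable. Put $$f(x)=\int h(x,z)\,P(dz),\quad \hat f_n(x)=\frac1n\sum_{i=1}^n h(x,\xi_i),\quad \psi^*=\inf_{x\in X} f(x),\quad \hat\psi_n=\inf_{x\in X}\hat f_n(x),\quad S^\varepsilon=\{x\in X: f(x)\le\psi^*+\varepsilon\}.$$ Let $\ell^\infty(X)$ be the space of bounded real functions on $X$ with the supremum norm, and let $\iota:\ell^\infty(X)\to\mathbb R$, $\iota(g)=\inf_{x\in X} g(x)$. For a map $U:\Omega\to[-\infty,\infty]$ let $\mathbb E^*U=\inf\{\mathbb E V: V\ge U,\ V \text{ measurable},\ \mathbb E V\text{ exists}\}$, and let $\mathbb P^*(A)=\mathbb E^*\mathbf 1_A$. For arbitrary maps $Z_n:\Omega\to E$ into a topological space and a Borel measurable $E$-valued random element $L$ (possibly on another probability space), $Z_n\rightsquigarrow L$ means $\mathbb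 E^*\varphi(Z_n)\to\mathbb E\varphi(L)$ for all bounded continuous $\varphi:E\to\mathbb R$ (weak convergence in the Hoffmann–Jørgensen sense). For real maps, $U_n=o_{\mathbb P^*}(1)$ means $\mathbb P^*(|U_n|>\eta)\to0$ for every $\eta>0$. **Theorem (Weak limit of the optimal value).** Suppose that $f$ is bounded, that for all sufficiently large $n$ the function $\hat f_n$ is almost surely bounded, and that, for a deterministic real sequence $\tau_n\to\infty$ and a Borel measurable $\ell^\infty(X)$-valued random element $G$, $$\tau_n(\hat f_n-f)\rightsquigarrow G\quad\text{in }\ell^\infty(X)$$ (on the exceptional null sets $\tau_n(\hat f_n-f)$ is given an arbitrary value in $\ell^\infty(X)$). Then $\iota$ is Hadamard directionally differentiable at $f$, with directional derivative $$\iota_f'(g)=\lim_{\varepsilon\downarrow0}\ \inf_{x\in S^\varepsilon} g(x),\qquad g\in\ell^\infty(X),$$ where the limit exists for every $g$; that is, $t^{-1}(\iota(f+tk)-\iota(f))\to\iota_f'(g)$ as $t\downarrow0$ and $k\to g$ in $\ell^\infty(X)$. The map $\iota_f'(G)$ is Borel measurable, $$\tau_n(\hat\psi_n-\psi^*)\ \rightsquigarrow\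 \iota_f'(G)=\lim_{\varepsilon\downarrow0}\ \inf_{x\in S^\varepsilon}G(x),$$ and $$\tau_n(\hat\psi_n-\psi^*)-\iota_f'\bigl(\tau_n(\hat f_n-f)\bigr)=o_{\mathbb P^*}(1).$$ -/

import Mathlib

open Filter Topology MeasureTheory ProbabilityTheory
open scoped ENNReal BoundedContinuousFunction

noncomputable section

/-- The outer expectation `E* U` of an arbitrary map `U` into the extended reals: the infimum of the
expectations `E V = E V⁺ - E V⁻` over the measurable majorants `V` of `U` whose expectation exists,
i.e. for which `E V⁺` and `E V⁻` are not both infinite. -/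
def outerExpectation {Ω : Type*} [MeasurableSpace Ω] (μ : Measure Ω) (U : Ω → EReal) : EReal :=
  sInf {e : EReal | ∃ V : Ω → EReal, Measurable V ∧ (∀ ω, U ω ≤ V ω) ∧
    ((∫⁻ ω, (V ω).toENNReal ∂μ) ≠ ⊤ ∨ (∫⁻ ω, (-V ω).toENNReal ∂μ) ≠ ⊤) ∧
    e = ((∫⁻ ω, (V ω).toENNReal ∂μ : ℝ≥0∞) : EReal) -
      ((∫⁻ ω, (-V ω).toENNReal ∂μ : ℝ≥0∞) : EReal)}

/-- The outer probability `P* A = E* 1_A` of an arbitrary set. -/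
def outerProbability {Ω : Type*} [MeasurableSpace Ω] (μ : Measure Ω) (A : Set Ω) : EReal :=
  outerExpectation μ (A.indicator 1)

/-- `U n = o_{P*}(1)`: the real maps `U n` converge to zero in outer probability. -/
def TendstoZeroInOuterProbability {Ω : Type*} [MeasurableSpace Ω] (μ : Measure Ω)
    (U : ℕ → Ω → ℝ) : Prop :=
  ∀ η : ℝ, 0 < η → Tendsto (fun n => outerProbability μ {ω | η < |U n ω|}) atTop (𝓝 0)

/-- Weak convergence `Z n ⇝ L` in the sense of Hoffmann-Jørgensen: the maps `Z n` are arbitrary, the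
limit `L` (possibly on another probability space) is Borel measurable, and
`E* φ(Z n) → E φ(L)` for every bounded continuous real function `φ`. -/
structure HJWeakConvergence {Ω Ω' E : Type*} [MeasurableSpace Ω] [MeasurableSpace Ω']
    [TopologicalSpace E] (μ : Measure Ω) (μ' : Measure Ω') (Z : ℕ → Ω → E) (L : Ω' → E) :
    Prop where
  borel_measurable : @Measurable Ω' E _ (borel E) L
  tendsto_outerExpectation : ∀ φ : E →ᵇ ℝ,
    Tendsto (fun n => outerExpectation μ (fun ω => ((φ (Z n ω) : ℝ) : EReal))) atTop
      (𝓝 ((∫ ω, φ (L ω) ∂μ' : ℝ) : EReal))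

/-- The Banach space `ℓ∞(X)` of bounded real functions on `X` with the supremum norm. -/
abbrev LInf (X : Type*) : Type _ := lp (fun _ : X => ℝ) ∞

open Classical in
/-- A bounded function as an element of `ℓ∞(X)`. The value `0` at unbounded functions is a
convention: it extends a map that is `ℓ∞(X)`-valued almost surely to the exceptional null set. -/
def toLInf {X : Type*} (g : X → ℝ) : LInf X :=
  if hg : Memℓp g ∞ then ⟨g, hg⟩ else 0

/-- The infimum functional on `ℓ∞(X)`. -/
def infimum {X : Type*} (g : LInf X) : ℝ := ⨅ x, g x

/-- The set of `ε`-minimizers of `f`. -/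
def nearMinimizers {X : Type*} (f : X → ℝ) (ε : ℝ) : Set X := {x | f x ≤ (⨅ y, f y) + ε}

/-- `φ` is Hadamard directionally differentiable at `u` with directional derivative `D`:
`(φ (u + t • k) - φ u) / t → D g` as `t ↓ 0` and `k → g`, for every direction `g`. -/
def HasHadamardDirDerivAt {U V : Type*} [NormedAddCommGroup U] [NormedSpace ℝ U]
    [NormedAddCommGroup V] [NormedSpace ℝ V] (φ : U → V) (D : U → V) (u : U) : Prop :=
  ∀ g : U, Tendsto (fun p : ℝ × U => p.1⁻¹ • (φ (u + p.1 • p.2) - φ u))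
    (𝓝[>] (0 : ℝ) ×ˢ 𝓝 g) (𝓝 (D g))

/-- The expected objective `f x = P h_x`. -/
def expectedObjective {X Ξ : Type*} [MeasurableSpace Ξ] (P : Measure Ξ) (h : X → Ξ → ℝ)
    (x : X) : ℝ := ∫ z, h x z ∂P

/-- The empirical objective `(1/n) ∑ h(x, ξ i)`, over the first `n` sample points
`ξ 0, …, ξ (n - 1)`. -/
def empiricalObjective {X Ξ Ω : Type*} (h : X → Ξ → ℝ) (ξ : ℕ → Ω → Ξ) (n : ℕ) (ω : Ω)
    (x : X) : ℝ := (1 / (n : ℝ)) * ∑ i ∈ Finset.range n, h x (ξ i ω)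

end

/-! The infimum is a concave, `1`-Lipschitz functional on `ℓ∞(X)`, so it suffices to prove a delta
method for continuous concave functionals. For these the difference quotients
`t⁻¹ (φ (u + t g) - φ u)` are continuous in `g` and increase to the directional derivative `D g` as
`t ↓ 0`. Hence, once `(τ n)⁻¹ ≤ t`, the rescaled increment of `φ` lies between the quotient with the
fixed step `t`, evaluated at `Z n`, and `D (Z n)`. Both bounds are continuous functions of `Z n`
that are close under the limit law when `t` is small. This monotone sandwich takes the place of the
tightness or separability of the limit that a general delta method requires. -/

section OuterExpectation

variable {Ω : Type*} [MeasurableSpace Ω] {μ : Measure Ω}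

theorem outerExpectation_mono_ae {U U' : Ω → EReal} (hU : U ≤ᵐ[μ] U') :
    outerExpectation μ U ≤ outerExpectation μ U' := by
  classical
  refine le_sInf ?_
  rintro _ ⟨V, hV, hUV, hfin, rfl⟩
  obtain ⟨N, hsub, hN, hN0⟩ := exists_measurable_superset_of_null (ae_iff.mp hU)
  -- A majorant of `U'` becomes one of `U` after it is raised to `⊤` on the exceptional null set.
  let W : Ω → EReal := N.piecewise (fun _ => ⊤) V
  have hWV : W =ᵐ[μ] V := by
    filter_upwards [measure_eq_zero_iff_ae_notMem.mp hN0] with ω hω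
    exact Set.piecewise_eq_of_notMem _ _ _ hω
  have hUW : ∀ ω, U ω ≤ W ω := fun ω => by
    by_cases hω : ω ∈ N
    · simp only [W, Set.piecewise_eq_of_mem _ _ _ hω, le_top]
    · simp only [W, Set.piecewise_eq_of_notMem _ _ _ hω]
      exact (not_not.mp fun hlt => hω (hsub hlt)).trans (hUV ω)
  have hpos : ∫⁻ ω, (W ω).toENNReal ∂μ = ∫⁻ ω, (V ω).toENNReal ∂μ :=
    lintegral_congr_ae (hWV.fun_comp EReal.toENNReal)
  have hneg : ∫⁻ ω, (-W ω).toENNReal ∂μ = ∫⁻ ω, (-V ω).toENNReal ∂μ :=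
    lintegral_congr_ae (hWV.fun_comp fun v => (-v).toENNReal)
  refine sInf_le ⟨W, measurable_const.piecewise hN hV, hUW, ?_, ?_⟩ <;> rw [hpos, hneg]
  exact hfin

theorem outerProbability_eq_outerExpectation_indicator (μ : Measure Ω) (A : Set Ω) :
    outerProbability μ A = outerExpectation μ (fun ω => ((A.indicator 1 ω : ℝ) : EReal)) := by
  rw [outerProbability]
  congr 1 with ω
  by_cases hω : ω ∈ A <;> simp [hω]

end OuterExpectation

section IntervalOscillation

/-- The largest deviation of `φ` from its value at `b` on the interval with endpoints `a` and `b`,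
in either order. It bounds `|φ x - φ b|` for `x` sandwiched between `a` and `b`, continuously in
`a` and `b`. -/
noncomputable def intervalOscillation (φ : ℝ → ℝ) (a b : ℝ) : ℝ :=
  sSup ((fun x => |φ x - φ b|) '' Set.uIcc a b)

variable {φ : ℝ → ℝ}

theorem abs_sub_le_intervalOscillation (hφ : Continuous φ) {a b x : ℝ} (hx : x ∈ Set.uIcc a b) :
    |φ x - φ b| ≤ intervalOscillation φ a b :=
  le_csSup (isCompact_uIcc.bddAbove_image (by fun_prop)) (Set.mem_image_of_mem _ hx)

theorem intervalOscillation_nonneg (φ : ℝ → ℝ) (a b : ℝ) : 0 ≤ intervalOscillation φ a b :=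
  Real.sSup_nonneg <| Set.forall_mem_image.mpr fun _ _ => abs_nonneg _

theorem intervalOscillation_le {C : ℝ} (hC : ∀ x, |φ x| ≤ C) (a b : ℝ) :
    intervalOscillation φ a b ≤ 2 * C := by
  refine csSup_le (Set.nonempty_uIcc.image _) (Set.forall_mem_image.mpr fun x _ => ?_)
  linarith [abs_sub (φ x) (φ b), hC x, hC b]

theorem intervalOscillation_self (φ : ℝ → ℝ) (a : ℝ) : intervalOscillation φ a a = 0 := by
  simp [intervalOscillation]

theorem continuous_intervalOscillation (hφ : Continuous φ) :
    Continuous fun p : ℝ × ℝ => intervalOscillation φ p.1 p.2 := by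
  -- Parametrizing the interval by `[0, 1]` makes the supremum range over a fixed compact set.
  simp only [intervalOscillation, ← segment_eq_uIcc, segment_eq_image_lineMap, Set.image_image,
    AffineMap.lineMap_apply_ring']
  exact isCompact_Icc.continuous_sSup
    (f := fun (p : ℝ × ℝ) (s : ℝ) => |φ (s * (p.2 - p.1) + p.1) - φ p.2|) (by fun_prop)

end IntervalOscillation

section Sandwich

variable {Ω Ω' E ι : Type*} [MeasurableSpace Ω] [MeasurableSpace Ω'] [TopologicalSpace E]
  {μ : Measure Ω} {μ' : Measure Ω'} [IsFiniteMeasure μ'] {Z : ℕ → Ω → E} {L : Ω' → E}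
  {l : Filter ι} [l.IsCountablyGenerated]

theorem tendsto_integral_comp_boundedContinuous (hL : @Measurable Ω' E _ (borel E) L)
    {Ψ : ι → E →ᵇ ℝ} {ψ : E → ℝ} {C : ℝ} (hC : ∀ i, ‖Ψ i‖ ≤ C)
    (hΨ : ∀ g, Tendsto (fun i => Ψ i g) l (𝓝 (ψ g))) :
    Tendsto (fun i => ∫ ω, Ψ i (L ω) ∂μ') l (𝓝 (∫ ω, ψ (L ω) ∂μ')) := by
  borelize E
  exact tendsto_integral_filter_of_norm_le_const
    (.of_forall fun i => ((Ψ i).continuous.measurable.comp hL).aestronglyMeasurable)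
    ⟨C, .of_forall fun i => ae_of_all _ fun ω => ((Ψ i).norm_coe_le_norm _).trans (hC i)⟩
    (ae_of_all _ fun ω => hΨ (L ω))

variable [l.NeBot]

theorem HJWeakConvergence.tendsto_outerExpectation_of_abs_sub_le
    (hZ : HJWeakConvergence μ μ' Z L) (Φ : E →ᵇ ℝ) {W : ι → E →ᵇ ℝ} {C : ℝ} (hC : ∀ i, ‖W i‖ ≤ C)
    (hW : ∀ g, Tendsto (fun i => W i g) l (𝓝 0)) {V : ℕ → Ω → ℝ}
    (hV : ∀ᶠ i in l, ∀ᶠ n in atTop, ∀ᵐ ω ∂μ, |V n ω - Φ (Z n ω)| ≤ W i (Z n ω)) :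
    Tendsto (fun n => outerExpectation μ (fun ω => ((V n ω : ℝ) : EReal))) atTop
      (𝓝 ((∫ ω, Φ (L ω) ∂μ' : ℝ) : EReal)) := by
  have hlower : Tendsto (fun i => ∫ ω, (Φ - W i) (L ω) ∂μ') l (𝓝 (∫ ω, Φ (L ω) ∂μ')) :=
    tendsto_integral_comp_boundedContinuous hZ.borel_measurable
      (fun i => (norm_sub_le _ _).trans (add_le_add_right (hC i) ‖Φ‖))
      fun g => by simpa using tendsto_const_nhds.sub (hW g)
  have hupper : Tendsto (fun i => ∫ ω, (Φ + W i) (L ω) ∂μ') l (𝓝 (∫ ω, Φ (L ω) ∂μ')) :=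
    tendsto_integral_comp_boundedContinuous hZ.borel_measurable
      (fun i => (norm_add_le _ _).trans (add_le_add_right (hC i) ‖Φ‖))
      fun g => by simpa using tendsto_const_nhds.add (hW g)
  refine tendsto_order.mpr ⟨fun c hc => ?_, fun c hc => ?_⟩
  · obtain ⟨i, hci, hVi⟩ :=
      (((EReal.tendsto_coe.mpr hlower).eventually_const_lt hc).and hV).exists
    filter_upwards [(hZ.tendsto_outerExpectation (Φ - W i)).eventually_const_lt hci, hVi]
      with n hn hVn
    refine hn.trans_le (outerExpectation_mono_ae ?_)
    filter_upwards [hVn] with ω hω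
    exact EReal.coe_le_coe_iff.mpr (sub_le_of_abs_sub_le_left hω)
  · obtain ⟨i, hci, hVi⟩ :=
      (((EReal.tendsto_coe.mpr hupper).eventually_lt_const hc).and hV).exists
    filter_upwards [(hZ.tendsto_outerExpectation (Φ + W i)).eventually_lt_const hci, hVi]
      with n hn hVn
    refine (outerExpectation_mono_ae ?_).trans_lt hn
    filter_upwards [hVn] with ω hω
    exact EReal.coe_le_coe_iff.mpr (sub_le_iff_le_add'.mp (le_of_abs_le hω))

variable {D : E → ℝ} {q : ι → E → ℝ} {V : ℕ → Ω → ℝ}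

theorem HJWeakConvergence.of_mem_uIcc (hZ : HJWeakConvergence μ μ' Z L) (hD : Continuous D)
    (hq : ∀ i, Continuous (q i)) (hqD : ∀ g, Tendsto (fun i => q i g) l (𝓝 (D g)))
    (hV : ∀ᶠ i in l, ∀ᶠ n in atTop, ∀ᵐ ω ∂μ, V n ω ∈ Set.uIcc (q i (Z n ω)) (D (Z n ω))) :
    HJWeakConvergence μ μ' V (fun ω => D (L ω)) where
  borel_measurable := by
    borelize E
    rw [← BorelSpace.measurable_eq (α := ℝ)]
    exact hD.measurable.comp hZ.borel_measurable
  tendsto_outerExpectation φ := by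
    have hosc := continuous_intervalOscillation φ.continuous
    have hbound : ∀ a b, ‖intervalOscillation φ a b‖ ≤ 2 * ‖φ‖ := fun a b => by
      rw [Real.norm_of_nonneg (intervalOscillation_nonneg φ a b)]
      exact intervalOscillation_le φ.norm_coe_le_norm a b
    let W (i : ι) : E →ᵇ ℝ := .ofNormedAddCommGroup
      (fun g => intervalOscillation φ (q i g) (D g)) (hosc.comp ((hq i).prodMk hD)) (2 * ‖φ‖)
      fun g => hbound _ _
    have hW : ∀ g, Tendsto (fun i => W i g) l (𝓝 0) := fun g => by
      have h := (hosc.tendsto (D g, D g)).comp ((hqD g).prodMk_nhds tendsto_const_nhds)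
      rwa [intervalOscillation_self] at h
    refine hZ.tendsto_outerExpectation_of_abs_sub_le (φ.compContinuous ⟨D, hD⟩) (W := W)
      (fun i => BoundedContinuousFunction.norm_ofNormedAddCommGroup_le _ (by positivity) _) hW ?_
    filter_upwards [hV] with i hVi
    filter_upwards [hVi] with n hVn
    filter_upwards [hVn] with ω hω using abs_sub_le_intervalOscillation φ.continuous hω

theorem HJWeakConvergence.tendstoZeroInOuterProbability_of_mem_uIcc
    (hZ : HJWeakConvergence μ μ' Z L) (hD : Continuous D) (hq : ∀ i, Continuous (q i))
    (hqD : ∀ g, Tendsto (fun i => q i g) l (𝓝 (D g)))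
    (hV : ∀ᶠ i in l, ∀ᶠ n in atTop, ∀ᵐ ω ∂μ, V n ω ∈ Set.uIcc (q i (Z n ω)) (D (Z n ω))) :
    TendstoZeroInOuterProbability μ (fun n ω => V n ω - D (Z n ω)) := by
  intro η hη
  let W (i : ι) : E →ᵇ ℝ := .ofNormedAddCommGroup
    (fun g => min (|D g - q i g| / η) 1)
    (((hD.sub (hq i)).abs.div_const η).min continuous_const) 1
    fun g => by
      rw [Real.norm_of_nonneg (by positivity)]
      exact min_le_right _ _
  have hW : ∀ g, Tendsto (fun i => W i g) l (𝓝 0) := fun g => by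
    have h := (((hqD g).const_sub (D g)).abs.div_const η).min (tendsto_const_nhds (x := (1 : ℝ)))
    rwa [sub_self, abs_zero, zero_div, min_eq_left zero_le_one] at h
  have hzero : ((∫ ω, (0 : E →ᵇ ℝ) (L ω) ∂μ' : ℝ) : EReal) = 0 := by simp
  simp only [outerProbability_eq_outerExpectation_indicator, ← hzero]
  refine hZ.tendsto_outerExpectation_of_abs_sub_le 0 (W := W)
    (fun i => BoundedContinuousFunction.norm_ofNormedAddCommGroup_le _ zero_le_one _) hW ?_
  filter_upwards [hV] with i hVi
  filter_upwards [hVi] with n hVn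
  filter_upwards [hVn] with ω hω
  by_cases hmem : η < |V n ω - D (Z n ω)|
  · have hle : η ≤ |D (Z n ω) - q i (Z n ω)| := by
      rw [abs_sub_comm] at hmem
      exact hmem.le.trans (Set.abs_sub_right_of_mem_uIcc hω)
    simpa [W, hmem] using (one_le_div hη).mpr hle
  · simpa [W, hmem] using div_nonneg (abs_nonneg _) hη.le

end Sandwich

section DifferenceQuotient

variable {U V : Type*} [NormedAddCommGroup U] [NormedSpace ℝ U] [NormedAddCommGroup V]
  [NormedSpace ℝ V] {φ D : U → V} {u : U} {K : NNReal}

/-- The difference quotient of `φ` at `u` with step `t`, as a function of the direction `g`; it is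
the expression whose limit defines the Hadamard directional derivative. -/
noncomputable def differenceQuotient (φ : U → V) (u : U) (t : ℝ) (g : U) : V :=
  t⁻¹ • (φ (u + t • g) - φ u)

theorem continuous_differenceQuotient (hφ : Continuous φ) (u : U) (t : ℝ) :
    Continuous (differenceQuotient φ u t) := by
  unfold differenceQuotient
  fun_prop

theorem lipschitzWith_differenceQuotient (hφ : LipschitzWith K φ) (u : U) (t : ℝ) :
    LipschitzWith K (differenceQuotient φ u t) := by
  refine LipschitzWith.of_dist_le_mul fun g k => ?_
  calc dist (differenceQuotient φ u t g) (differenceQuotient φ u t k)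
      = ‖t⁻¹‖ * dist (φ (u + t • g)) (φ (u + t • k)) := by
        rw [differenceQuotient, differenceQuotient, dist_smul₀, dist_sub_right]
    _ ≤ ‖t⁻¹‖ * (K * (‖t‖ * dist g k)) := by
        gcongr
        simpa only [dist_add_left, dist_smul₀] using hφ.dist_le_mul (u + t • g) (u + t • k)
    _ = (‖t⁻¹‖ * ‖t‖) * (K * dist g k) := by ring
    _ ≤ K * dist g k := by
        refine mul_le_of_le_one_left (by positivity) ?_
        rw [norm_inv]
        exact inv_mul_le_one

theorem hasHadamardDirDerivAt_of_lipschitzWith (hφ : LipschitzWith K φ)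
    (hD : ∀ g, Tendsto (fun t => differenceQuotient φ u t g) (𝓝[>] 0) (𝓝 (D g))) :
    HasHadamardDirDerivAt φ D u := by
  intro g
  have hfst : Tendsto (fun p : ℝ × U => differenceQuotient φ u p.1 g)
      (𝓝[>] (0 : ℝ) ×ˢ 𝓝 g) (𝓝 (D g)) := (hD g).comp tendsto_fst
  have hsnd : Tendsto (fun p : ℝ × U => K * dist g p.2) (𝓝[>] (0 : ℝ) ×ˢ 𝓝 g) (𝓝 0) := by
    have hdist : Tendsto (fun k => K * dist g k) (𝓝 g) (𝓝 0) :=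
      Continuous.tendsto' (by fun_prop) _ _ (by simp)
    exact hdist.comp tendsto_snd
  refine tendsto_of_tendsto_of_dist hfst (squeeze_zero (fun _ => dist_nonneg) (fun p => ?_) hsnd)
  exact (lipschitzWith_differenceQuotient hφ u p.1).dist_le_mul g p.2

theorem HasHadamardDirDerivAt.tendsto_differenceQuotient (hD : HasHadamardDirDerivAt φ D u)
    (g : U) : Tendsto (fun t => differenceQuotient φ u t g) (𝓝[>] 0) (𝓝 (D g)) :=
  (hD g).comp (tendsto_id.prodMk tendsto_const_nhds)

theorem HasHadamardDirDerivAt.continuous (hD : HasHadamardDirDerivAt φ D u) : Continuous D := by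
  refine continuous_iff_continuousAt.mpr fun g =>
    (closed_nhds_basis (D g)).tendsto_right_iff.mpr fun C ⟨hC, hC_closed⟩ => ?_
  have hmem : ∀ᶠ k in 𝓝 g, ∀ᶠ t in 𝓝[>] 0, differenceQuotient φ u t k ∈ C :=
    (tendsto_prod_swap.eventually ((hD g).eventually hC)).curry
  filter_upwards [hmem] with k hk
  exact hC_closed.mem_of_tendsto (hD.tendsto_differenceQuotient k) hk

end DifferenceQuotient

section ConcaveDeltaMethod

variable {E : Type*} [NormedAddCommGroup E] [NormedSpace ℝ E] {φ D : E → ℝ} {u : E}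

theorem antitoneOn_differenceQuotient (hφ : ConcaveOn ℝ Set.univ φ) (u g : E) :
    AntitoneOn (fun t => differenceQuotient φ u t g) (Set.Ioi 0) := by
  have hline : ConcaveOn ℝ Set.univ fun t : ℝ => φ (u + t • g) := by
    simpa [Function.comp_def, AffineMap.lineMap_apply, add_comm] using
      hφ.comp_affineMap (AffineMap.lineMap u (u + g))
  have hslope : (fun t => differenceQuotient φ u t g) = slope (fun t : ℝ => φ (u + t • g)) 0 := by
    ext t
    simp [differenceQuotient, slope_def_module]
  rw [hslope]
  exact (hline.slope_anti (Set.mem_univ 0)).mono fun t ht => ⟨Set.mem_univ t, ne_of_gt ht⟩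

theorem HasHadamardDirDerivAt.differenceQuotient_le (hD : HasHadamardDirDerivAt φ D u)
    (hφ : ConcaveOn ℝ Set.univ φ) {t : ℝ} (ht : 0 < t) (g : E) :
    differenceQuotient φ u t g ≤ D g := by
  refine ge_of_tendsto (hD.tendsto_differenceQuotient g) ?_
  filter_upwards [Ioc_mem_nhdsGT ht] with s hs
  exact antitoneOn_differenceQuotient hφ u g hs.1 ht hs.2

variable {Ω Ω' : Type*} [MeasurableSpace Ω] [MeasurableSpace Ω'] {μ : Measure Ω} {μ' : Measure Ω'}
  {Z : ℕ → Ω → E} {L : Ω' → E} {τ : ℕ → ℝ} {V : ℕ → Ω → ℝ}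

theorem HasHadamardDirDerivAt.eventually_mem_uIcc (hD : HasHadamardDirDerivAt φ D u)
    (hφ : ConcaveOn ℝ Set.univ φ) (hτ : Tendsto τ atTop atTop)
    (hV : ∀ᶠ n in atTop, ∀ᵐ ω ∂μ, V n ω = differenceQuotient φ u (τ n)⁻¹ (Z n ω)) :
    ∀ᶠ t in 𝓝[>] 0, ∀ᶠ n in atTop, ∀ᵐ ω ∂μ,
      V n ω ∈ Set.uIcc (differenceQuotient φ u t (Z n ω)) (D (Z n ω)) := by
  filter_upwards [self_mem_nhdsWithin] with t ht
  filter_upwards [hV, hτ.inv_tendsto_atTop.eventually_le_const ht, hτ.eventually_gt_atTop 0]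
    with n hVn hle hpos
  filter_upwards [hVn] with ω hω
  rw [hω]
  exact Set.mem_uIcc_of_le
    (antitoneOn_differenceQuotient hφ u _ (inv_pos.mpr hpos) ht hle)
    (hD.differenceQuotient_le hφ (inv_pos.mpr hpos) _)

variable [IsFiniteMeasure μ']

theorem HJWeakConvergence.delta_method_of_concaveOn (hZ : HJWeakConvergence μ μ' Z L)
    (hφ : ConcaveOn ℝ Set.univ φ) (hφ_cont : Continuous φ) (hD : HasHadamardDirDerivAt φ D u)
    (hτ : Tendsto τ atTop atTop)
    (hV : ∀ᶠ n in atTop, ∀ᵐ ω ∂μ, V n ω = differenceQuotient φ u (τ n)⁻¹ (Z n ω)) :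
    HJWeakConvergence μ μ' V (fun ω => D (L ω)) :=
  hZ.of_mem_uIcc hD.continuous (continuous_differenceQuotient hφ_cont u)
    hD.tendsto_differenceQuotient (hD.eventually_mem_uIcc hφ hτ hV)

theorem HJWeakConvergence.delta_expansion_of_concaveOn (hZ : HJWeakConvergence μ μ' Z L)
    (hφ : ConcaveOn ℝ Set.univ φ) (hφ_cont : Continuous φ) (hD : HasHadamardDirDerivAt φ D u)
    (hτ : Tendsto τ atTop atTop)
    (hV : ∀ᶠ n in atTop, ∀ᵐ ω ∂μ, V n ω = differenceQuotient φ u (τ n)⁻¹ (Z n ω)) :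
    TendstoZeroInOuterProbability μ (fun n ω => V n ω - D (Z n ω)) :=
  hZ.tendstoZeroInOuterProbability_of_mem_uIcc hD.continuous
    (continuous_differenceQuotient hφ_cont u) hD.tendsto_differenceQuotient
    (hD.eventually_mem_uIcc hφ hτ hV)

end ConcaveDeltaMethod

section Infimum

variable {X : Type*}

theorem LInf.abs_apply_le_norm (g : LInf X) (x : X) : |g x| ≤ ‖g‖ :=
  lp.norm_apply_le_norm ENNReal.top_ne_zero g x

theorem LInf.bddBelow_range_comp {ι : Type*} (g : LInf X) (e : ι → X) :
    BddBelow (Set.range fun i => g (e i)) :=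
  ⟨-‖g‖, Set.forall_mem_range.mpr fun i => neg_le_of_abs_le (g.abs_apply_le_norm (e i))⟩

theorem infimum_le (g : LInf X) (x : X) : infimum g ≤ g x :=
  ciInf_le (g.bddBelow_range_comp id) x

theorem nearMinimizers_mono (f : X → ℝ) : Monotone (nearMinimizers f) :=
  fun _ _ hεδ _ hx => le_trans (α := ℝ) hx (by gcongr)

/-- The infimum of `g` over the `ε`-minimizers of `f`, whose limit as `ε ↓ 0` is the directional
derivative of the infimum at `f`. -/
noncomputable def nearInfimum (f : X → ℝ) (g : LInf X) (ε : ℝ) : ℝ := ⨅ x : nearMinimizers f ε, g x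

/-- The directional derivative of the infimum at `f` in direction `g`. Since `nearInfimum f g`
increases as `ε ↓ 0`, its limit is encoded as a supremum. -/
noncomputable def infimumDeriv (f : X → ℝ) (g : LInf X) : ℝ := sSup (nearInfimum f g '' Set.Ioi 0)

theorem nearInfimum_le (g : LInf X) {f : X → ℝ} {ε : ℝ} {x : X} (hx : x ∈ nearMinimizers f ε) :
    nearInfimum f g ε ≤ g x :=
  ciInf_le (g.bddBelow_range_comp Subtype.val) (⟨x, hx⟩ : nearMinimizers f ε)

theorem mul_iInf_sub_iInf_eq_differenceQuotient (f : LInf X) {v : X → ℝ} (hv : Memℓp v ∞) {r : ℝ}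
    (hr : r ≠ 0) :
    r * ((⨅ x, v x) - ⨅ x, f x) =
      differenceQuotient infimum f r⁻¹ (toLInf fun x => r * (v x - f x)) := by
  have hmem : Memℓp (fun x => r * (v x - f x)) ∞ := (hv.sub f.2).const_mul r
  have hval : f + r⁻¹ • toLInf (fun x => r * (v x - f x)) = ⟨v, hv⟩ := by
    ext x
    simp only [toLInf, dif_pos hmem, lp.coeFn_add, lp.coeFn_smul, Pi.add_apply, Pi.smul_apply,
      smul_eq_mul, inv_mul_cancel_left₀ hr, add_sub_cancel]
  rw [differenceQuotient, hval, inv_inv]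
  rfl

variable [Nonempty X]

theorem lipschitzWith_infimum : LipschitzWith 1 (infimum : LInf X → ℝ) := by
  refine LipschitzWith.of_le_add fun g k => ?_
  rw [← sub_le_iff_le_add]
  refine le_ciInf fun x => ?_
  have hgk : g x - k x ≤ ‖g - k‖ := le_of_abs_le ((g - k).abs_apply_le_norm x)
  rw [dist_eq_norm]
  linarith [infimum_le g x]

theorem concaveOn_infimum : ConcaveOn ℝ Set.univ (infimum : LInf X → ℝ) :=
  ⟨convex_univ, fun g _ k _ _ _ ha hb _ => le_ciInf fun x =>
    add_le_add (mul_le_mul_of_nonneg_left (infimum_le g x) ha)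
      (mul_le_mul_of_nonneg_left (infimum_le k x) hb)⟩

theorem nearMinimizers_nonempty (f : X → ℝ) {ε : ℝ} (hε : 0 < ε) :
    (nearMinimizers f ε).Nonempty :=
  (exists_lt_of_ciInf_lt (lt_add_of_pos_right (⨅ y, f y) hε)).imp fun _ => le_of_lt

theorem nearInfimum_le_norm (f : X → ℝ) (g : LInf X) {ε : ℝ} (hε : 0 < ε) :
    nearInfimum f g ε ≤ ‖g‖ :=
  have ⟨x, hx⟩ := nearMinimizers_nonempty f hε
  (nearInfimum_le g hx).trans (le_of_abs_le (g.abs_apply_le_norm x))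

theorem antitoneOn_nearInfimum (f : X → ℝ) (g : LInf X) :
    AntitoneOn (nearInfimum f g) (Set.Ioi 0) := fun _ hε _ _ hεδ =>
  have := (nearMinimizers_nonempty f hε).to_subtype
  le_ciInf fun x => nearInfimum_le g (nearMinimizers_mono f hεδ x.2)

theorem tendsto_nearInfimum (f : X → ℝ) (g : LInf X) :
    Tendsto (nearInfimum f g) (𝓝[>] 0) (𝓝 (infimumDeriv f g)) :=
  (antitoneOn_nearInfimum f g).tendsto_nhdsGT
    ⟨‖g‖, Set.forall_mem_image.mpr fun _ hε => nearInfimum_le_norm f g hε⟩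

theorem differenceQuotient_infimum_le_nearInfimum (f g : LInf X) {t ε : ℝ} (ht : 0 < t)
    (hε : 0 < ε) : differenceQuotient infimum f t g ≤ nearInfimum f g ε + t⁻¹ * ε := by
  have := (nearMinimizers_nonempty f hε).to_subtype
  rw [← sub_le_iff_le_add]
  refine le_ciInf fun ⟨x, hx⟩ => ?_
  have hf : f x ≤ infimum f + ε := hx
  have hinf : infimum (f + t • g) ≤ f x + t * g x := infimum_le (f + t • g) x
  rw [differenceQuotient, smul_eq_mul, ← mul_sub, inv_mul_le_iff₀ ht]
  linarith

theorem nearInfimum_le_differenceQuotient_infimum (f g : LInf X) {t : ℝ} (ht : 0 < t) :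
    nearInfimum f g (t * (2 * ‖g‖ + 1)) ≤ differenceQuotient infimum f t g := by
  set ε := t * (2 * ‖g‖ + 1)
  have hε : 0 < ε := by positivity
  rw [differenceQuotient, smul_eq_mul, le_inv_mul_iff₀ ht, le_sub_iff_add_le]
  refine le_ciInf fun x => ?_
  change t * nearInfimum f g ε + infimum f ≤ f x + t * g x
  by_cases hx : x ∈ nearMinimizers f ε
  · rw [add_comm]
    exact add_le_add (infimum_le f x) (mul_le_mul_of_nonneg_left (nearInfimum_le g hx) ht.le)
  · -- Off the `ε`-minimizers the excess `ε > 2 t ‖g‖` of `f` outweighs the perturbation `t g`.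
    have hfx : infimum f + ε < f x := not_le.mp hx
    have hnear := mul_le_mul_of_nonneg_left (nearInfimum_le_norm f g hε) ht.le
    have hgx := mul_le_mul_of_nonneg_left (neg_le_of_abs_le (g.abs_apply_le_norm x)) ht.le
    linarith

theorem tendsto_differenceQuotient_infimum (f g : LInf X) :
    Tendsto (fun t => differenceQuotient infimum f t g) (𝓝[>] 0) (𝓝 (infimumDeriv f g)) := by
  have hnear {e : ℝ → ℝ} (he : Continuous e) (he0 : e 0 = 0) (hpos : ∀ t > 0, 0 < e t) :
      Tendsto (fun t => nearInfimum f g (e t)) (𝓝[>] 0) (𝓝 (infimumDeriv f g)) :=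
    (tendsto_nearInfimum f g).comp <| tendsto_nhdsWithin_iff.mpr
      ⟨(he.tendsto' 0 0 he0).mono_left nhdsWithin_le_nhds, eventually_mem_nhdsWithin.mono hpos⟩
  have hlower := hnear (e := fun t => t * (2 * ‖g‖ + 1)) (by fun_prop) (zero_mul _)
    fun t ht => by positivity
  have hupper : Tendsto (fun t => nearInfimum f g (t * t) + t) (𝓝[>] 0)
      (𝓝 (infimumDeriv f g)) := by
    simpa using (hnear (e := fun t => t * t) (by fun_prop) (zero_mul _)
      fun t ht => mul_pos ht ht).add (tendsto_id.mono_left nhdsWithin_le_nhds)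
  refine tendsto_of_tendsto_of_tendsto_of_le_of_le' hlower hupper ?_ ?_ <;>
    filter_upwards [self_mem_nhdsWithin] with t ht
  · exact nearInfimum_le_differenceQuotient_infimum f g ht
  · simpa [(Set.mem_Ioi.mp ht).ne'] using
      differenceQuotient_infimum_le_nearInfimum f g ht (mul_pos ht ht)

theorem hasHadamardDirDerivAt_infimum (f : LInf X) :
    HasHadamardDirDerivAt infimum (infimumDeriv f) f :=
  hasHadamardDirDerivAt_of_lipschitzWith lipschitzWith_infimum
    (tendsto_differenceQuotient_infimum f)

end Infimum

theorem mainTheorem2_general {X Ω Ω' : Type*} [Nonempty X] [MeasurableSpace Ω] [MeasurableSpace Ω']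
    {μ : Measure Ω} {μ' : Measure Ω'} [IsFiniteMeasure μ'] (f : LInf X) {F : ℕ → Ω → X → ℝ}
    (hF : ∀ᶠ n in atTop, ∀ᵐ ω ∂μ, Memℓp (F n ω) ∞) {τ : ℕ → ℝ} (hτ : Tendsto τ atTop atTop)
    {G : Ω' → LInf X}
    (hG : HJWeakConvergence μ μ' (fun n ω => toLInf fun x => τ n * (F n ω x - f x)) G) :
    ∃ D : LInf X → ℝ,
      HasHadamardDirDerivAt infimum D f ∧
      (∀ g : LInf X,
        Tendsto (fun ε : ℝ => ⨅ x : nearMinimizers f ε, g x) (𝓝[>] 0) (𝓝 (D g))) ∧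
      HJWeakConvergence μ μ' (fun n ω => τ n * ((⨅ x, F n ω x) - ⨅ x, f x))
        (fun ω' => D (G ω')) ∧
      TendstoZeroInOuterProbability μ
        (fun n ω => τ n * ((⨅ x, F n ω x) - ⨅ x, f x) -
          D (toLInf fun x => τ n * (F n ω x - f x))) := by
  have hquotient : ∀ᶠ n in atTop, ∀ᵐ ω ∂μ, τ n * ((⨅ x, F n ω x) - ⨅ x, f x) =
      differenceQuotient infimum f (τ n)⁻¹ (toLInf fun x => τ n * (F n ω x - f x)) := by
    filter_upwards [hF, hτ.eventually_ne_atTop 0] with n hFn hτn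
    filter_upwards [hFn] with ω hω using mul_iInf_sub_iInf_eq_differenceQuotient f hω hτn
  have hcont : Continuous (infimum : LInf X → ℝ) := lipschitzWith_infimum.continuous
  have hderiv := hasHadamardDirDerivAt_infimum f
  exact ⟨infimumDeriv f, hderiv, tendsto_nearInfimum f,
    hG.delta_method_of_concaveOn concaveOn_infimum hcont hderiv hτ hquotient,
    hG.delta_expansion_of_concaveOn concaveOn_infimum hcont hderiv hτ hquotient⟩

theorem mainTheorem2 {X Ξ Ω Ω' : Type*} [Nonempty X]
    [MeasurableSpace Ξ] [MeasurableSpace Ω] [MeasurableSpace Ω']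
    (P : Measure Ξ) [IsProbabilityMeasure P]
    (μ : Measure Ω) [IsProbabilityMeasure μ]
    (μ' : Measure Ω') [IsProbabilityMeasure μ']
    -- the loss and the i.i.d. sample with law `P`
    (h : X → Ξ → ℝ) (h_meas : ∀ x, Measurable (h x)) (h_int : ∀ x, Integrable (h x) P)
    (ξ : ℕ → Ω → Ξ) (ξ_meas : ∀ i, Measurable (ξ i)) (ξ_indep : iIndepFun ξ μ)
    (ξ_law : ∀ i, μ.map (ξ i) = P)
    -- boundedness of the objectives
    (hf : Memℓp (expectedObjective P h) ∞)
    (hfn : ∀ᶠ n in atTop, ∀ᵐ ω ∂μ, Memℓp (empiricalObjective h ξ n ω) ∞)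
    -- weak convergence of the rescaled objectives
    (τ : ℕ → ℝ) (hτ : Tendsto τ atTop atTop)
    (G : Ω' → LInf X)
    (hG : HJWeakConvergence μ μ'
      (fun n ω => toLInf fun x =>
        τ n * (empiricalObjective h ξ n ω x - expectedObjective P h x)) G) :
    ∃ D : LInf X → ℝ,
      -- `D` is the directional derivative of the infimum map at `f`, given by the limit formula
      HasHadamardDirDerivAt infimum D (⟨expectedObjective P h, hf⟩ : LInf X) ∧
      (∀ g : LInf X,
        Tendsto (fun ε : ℝ => ⨅ x : nearMinimizers (expectedObjective P h) ε, g x)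
          (𝓝[>] 0) (𝓝 (D g))) ∧
      -- weak limit of the optimal values
      HJWeakConvergence μ μ'
        (fun n ω => τ n * ((⨅ x, empiricalObjective h ξ n ω x) - ⨅ x, expectedObjective P h x))
        (fun ω' => D (G ω')) ∧
      -- first-order expansion
      TendstoZeroInOuterProbability μ
        (fun n ω => τ n * ((⨅ x, empiricalObjective h ξ n ω x) - ⨅ x, expectedObjective P h x) -
          D (toLInf fun x =>
            τ n * (empiricalObjective h ξ n ω x - expectedObjective P h x))) :=
  mainTheorem2_general ⟨expectedObjective P h, hf⟩ hfn hτ hG
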